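/- **Theorem 4.5** (law of large numbers). Let $1<\alpha<2$, $0<d<1-\frac1\alpha$ and $1<p<\alpha$. Let $\{L_\alpha(t)\}_{t\in\mathbb R}$ be a symmetric $\alpha$-stable process with Lebesgue control measure on a probability space $(\Omega,\mathcal F,\mathbb P)$, that is, $L_\alpha(0)=0$ a.s., $L_\alpha$ has independent increments, and $\mathbb E\,e^{i\theta(L_\alpha(t)-L_\alpha(s))}=e^{-(t-s)|\theta|^\alpha}$ for all $s\le t$ and $\theta\in\mathbb R$. For $f\in L^\alpha(\mathbb R)$ let $\int_{\mathbb R} f\,dL_\alpha$ denote the stable stochastic integral: the limit in probability of $\int_{\mathbb R}\varphi_k\,dL_\alpha$ for any step functions $\varphi_k\to f$ in $L^\alpha(\mathbb R)$, where $\int_{\mathbb R}\sum_i a_i\mathbf 1_{(t_i,t_{i+1}]}\,dL_\alpha=\sum_i a_i\,(L_\alpha(t_{i+1})-L_\alpha(t_i))$. Let $g:\mathbb R\to\mathbb R$ be measurable with $g(t)=0$ for all $t<0$ and $|g(t)|\le Ce^{-ct}$ for all $t$, for some constants $C,c>0$, and put $$(I_+^dg)(x)=\frac1{\Gamma(d)}\int_{-\infty}^x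 g(t)(x-t)^{d-1}\,dt,\qquad Y_d(t)=\int_{-\infty}^t (I_+^dg)(t-x)\,dL_\alpha(x),\quad t\in\mathbb R .$$ Then the stochastic integrals defining $Y_d(t)$ exist for all $t\in\mathbb R$, and, with the sampling times $t_j=j$, the partial sums $S_n=\sum_{j=1}^n Y_d(j)$ belong to $L^p(\Omega,\mathbb P)$ and satisfy $$\frac{S_n}{n}\to 0\quad\text{in } L^p(\Omega,\mathbb P)\text{ as } n\to\infty .$$ -/

import Mathlib

open MeasureTheory ProbabilityTheory Filter Topology

/-- The two-sided symmetric `α`-stable process with Lebesgue control measure on the probability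
space `(Ω, P)`: it starts at `0`, has independent increments, and `L t - L s ~ S_α((t-s)^{1/α}, 0, 0)`
for `s ≤ t`, i.e. the increment has characteristic function `θ ↦ exp (-(t - s) |θ|^α)`. -/
structure IsSaSLevyMotion {Ω : Type*} [MeasurableSpace Ω] (P : Measure Ω) (α : ℝ)
    (L : ℝ → Ω → ℝ) : Prop where
  measurable : ∀ t, Measurable (L t)
  zero : L 0 =ᵐ[P] 0
  indep : HasIndepIncrements L P
  charFun_increment : ∀ s t, s ≤ t → ∀ θ : ℝ,
    charFun (P.map (fun ω => L t ω - L s ω)) θ = ((Real.exp (-((t - s) * |θ| ^ α)) : ℝ) : ℂ)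

/-- A step function `∑ i, a i • 1_{(t i, t (i+1)]}` on the line with `t 0 < t 1 < ⋯ < t n`. -/
structure StepFun where
  n : ℕ
  t : Fin (n + 1) → ℝ
  a : Fin n → ℝ
  strictMono_t : StrictMono t

/-- The function `∑ i, a i • 1_{(t i, t (i+1)]}`. -/
noncomputable def StepFun.toFun (φ : StepFun) (x : ℝ) : ℝ :=
  ∑ i, (Set.Ioc (φ.t i.castSucc) (φ.t i.succ)).indicator (fun _ => φ.a i) x

/-- The elementary integral `∑ i, a i (L (t (i+1)) - L (t i))` of a step function. -/
def StepFun.integral {Ω : Type*} (φ : StepFun) (L : ℝ → Ω → ℝ) (ω : Ω) : ℝ :=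
  ∑ i, φ.a i * (L (φ.t i.succ) ω - L (φ.t i.castSucc) ω)

/-- `X` is a version of the stable stochastic integral `∫ f dL` of `f ∈ L^α(ℝ)`: for every sequence
of step functions tending to `f` in `L^α(ℝ)`, the elementary integrals tend to `X` in probability. -/
def IsStableIntegral {Ω : Type*} [MeasurableSpace Ω] (P : Measure Ω) (α : ℝ) (L : ℝ → Ω → ℝ)
    (f : ℝ → ℝ) (X : Ω → ℝ) : Prop :=
  MemLp f (ENNReal.ofReal α) volume ∧ AEMeasurable X P ∧
    ∀ φ : ℕ → StepFun,
      Tendsto (fun k => eLpNorm (fun x => (φ k).toFun x - f x) (ENNReal.ofReal α) volume)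
        atTop (𝓝 0) →
      TendstoInMeasure P (fun k => (φ k).integral L) atTop X

open Classical in
/-- The stable stochastic integral `∫ f dL` (a chosen version; `0` when the integral does not
exist). -/
noncomputable def stableIntegral {Ω : Type*} [MeasurableSpace Ω] (P : Measure Ω) (α : ℝ)
    (L : ℝ → Ω → ℝ) (f : ℝ → ℝ) : Ω → ℝ :=
  if h : ∃ X, IsStableIntegral P α L f X then h.choose else 0

/-- The left-sided Riemann-Liouville fractional integral `I_+^d g`. -/
noncomputable def rlLeft (d : ℝ) (g : ℝ → ℝ) (x : ℝ) : ℝ :=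
  (1 / Real.Gamma d) * ∫ t in Set.Iic x, g t * (x - t) ^ (d - 1)

/-- The integrand `x ↦ 1_{x ≤ t} (I_+^d g)(t - x)` of the FIMA stable process at time `t`. -/
noncomputable def fimaKernel (d : ℝ) (g : ℝ → ℝ) (t : ℝ) : ℝ → ℝ :=
  (Set.Iic t).indicator (fun x => rlLeft d g (t - x))

/-- The fractionally integrated moving average (FIMA) stable process
`Y_d(t) = ∫_{-∞}^t (I_+^d g)(t - x) dL(x)`. -/
noncomputable def fimaProcess {Ω : Type*} [MeasurableSpace Ω] (P : Measure Ω) (α : ℝ)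
    (L : ℝ → Ω → ℝ) (d : ℝ) (g : ℝ → ℝ) (t : ℝ) : Ω → ℝ :=
  stableIntegral P α L (fimaKernel d g t)

/-- The partial sums `S_n = ∑_{j=1}^n Y_d(j)`. -/
noncomputable def fimaPartialSum {Ω : Type*} [MeasurableSpace Ω] (P : Measure Ω) (α : ℝ)
    (L : ℝ → Ω → ℝ) (d : ℝ) (g : ℝ → ℝ) (n : ℕ) (ω : Ω) : ℝ :=
  ∑ j ∈ Finset.Icc 1 n, fimaProcess P α L d g (j : ℝ) ω

/-! The partial mean `S_n / n` is the stable integral of the averaged kernel `n⁻¹ ∑ k(j - x)`, where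
`k` is `I_+^d g` cut off to the half-line `[0, ∞)`. Two facts then give the claim.

Stable integration is bounded from `L^α(ℝ)` into `L^p(P)` for `1 ≤ p < α`. An elementary integral is
a sum of independent stable increments, hence stable with scale equal to the `L^α` norm of its step
function, and a stable law has `p`-th moments controlled by its scale
(`exists_eLpNorm_le_of_charFun`). Density of step functions extends the bound to all integrands, and
to finite sums of integrals (`exists_eLpNorm_sum_stableIntegral_le`).

Averages of integer translates of any `L^α` function tend to `0` in `L^α` when `α > 1`
(`tendsto_eLpNorm_average_translates`). For a bounded function of compact support the sum of `n`
translates has norm of order at most `n^(1/α)`; the general case follows by approximation, since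
averaging is a contraction.

That `k ∈ L^α` comes from bounds of order `x^d` near `0` and `x^(d-1)` at infinity
(`memLp_indicator_rlLeft`). -/

/-! ### Tails and moments of symmetric stable laws -/

/-- The truncation inequality bounds the tail by the mean of `1 - charFun` over `|θ| ≤ 2/r`, and `1
- exp (-x) ≤ x` bounds that integrand. -/
theorem measure_lt_abs_le_of_charFun {Ω : Type*} [MeasurableSpace Ω] {P : Measure Ω}
    [IsProbabilityMeasure P] {α s : ℝ} (hα : 0 ≤ α) (hs : 0 ≤ s) {X : Ω → ℝ}
    (hX : AEMeasurable X P)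
    (h : ∀ θ : ℝ, charFun (P.map X) θ = ((Real.exp (-(s * |θ| ^ α)) : ℝ) : ℂ))
    {r : ℝ} (hr : 0 < r) :
    P {ω | r < |X ω|} ≤ ENNReal.ofReal (2 * 2 ^ α * s * r ^ (-α)) := by
  have : IsProbabilityMeasure (P.map X) := Measure.isProbabilityMeasure_map hX
  have h1 := measureReal_abs_gt_le_integral_charFun (μ := P.map X) hr
  have h2 : ‖∫ t in (-2 * r⁻¹)..(2 * r⁻¹), 1 - charFun (P.map X) t‖
      ≤ s * (2 * r⁻¹) ^ α * |2 * r⁻¹ - -2 * r⁻¹| := by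
    refine intervalIntegral.norm_integral_le_of_norm_le_const fun t ht => ?_
    have hab : -2 * r⁻¹ ≤ 2 * r⁻¹ := by nlinarith [inv_pos.2 hr]
    rw [Set.uIoc_of_le hab] at ht
    have ht' : |t| ≤ 2 * r⁻¹ := abs_le.2 ⟨by linarith [ht.1], ht.2⟩
    have h3 : |t| ^ α ≤ (2 * r⁻¹) ^ α := Real.rpow_le_rpow (abs_nonneg _) ht' hα
    have h4 : 0 ≤ s * |t| ^ α := by positivity
    rw [h, ← Complex.ofReal_one, ← Complex.ofReal_sub, Complex.norm_real, Real.norm_eq_abs,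
      abs_of_nonneg (by simpa using h4)]
    nlinarith [Real.add_one_le_exp (-(s * |t| ^ α))]
  have h3 : (P.map X).real {x | r < |x|} = P.real {ω | r < |X ω|} := by
    rw [measureReal_def, measureReal_def, Measure.map_apply_of_aemeasurable hX]
    · rfl
    · exact measurableSet_lt measurable_const measurable_id.abs
  rw [h3] at h1
  rw [← ENNReal.ofReal_toReal (measure_ne_top P {ω | r < |X ω|})]
  refine ENNReal.ofReal_le_ofReal (h1.trans ?_)
  have h5 : |2 * r⁻¹ - -2 * r⁻¹| = 4 * r⁻¹ := by
    rw [abs_of_nonneg] <;> ring_nf; positivity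
  calc 2⁻¹ * r * ‖∫ t in (-2 * r⁻¹)..(2 * r⁻¹), 1 - charFun (P.map X) t‖
      ≤ 2⁻¹ * r * (s * (2 * r⁻¹) ^ α * (4 * r⁻¹)) := by
        rw [← h5]; gcongr
    _ = 2 * 2 ^ α * s * r ^ (-α) := by
        rw [Real.mul_rpow (by norm_num) (by positivity), Real.inv_rpow hr.le, Real.rpow_neg hr.le]
        field_simp
        ring

/-- Layer-cake formula split at the scale `σ`: below `σ` the tail is at most `1`, above it the power
bound is integrable because `p < α`. -/
theorem lintegral_abs_rpow_le_of_tail {Ω : Type*} [MeasurableSpace Ω] {P : Measure Ω}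
    [IsProbabilityMeasure P] {α p A σ : ℝ} (hp : 0 < p) (hpα : p < α) (hA : 0 ≤ A) (hσ : 0 < σ)
    {X : Ω → ℝ} (hX : AEMeasurable X P)
    (h : ∀ r, 0 < r → P {ω | r < |X ω|} ≤ ENNReal.ofReal (A * σ ^ α * r ^ (-α))) :
    ∫⁻ ω, ENNReal.ofReal (|X ω| ^ p) ∂P ≤ ENNReal.ofReal (σ ^ p * (1 + A * p / (α - p))) := by
  have hαp : 0 < α - p := by linarith
  rw [lintegral_rpow_eq_lintegral_meas_lt_mul P (ae_of_all _ fun ω => abs_nonneg (X ω))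
    (by fun_prop) hp, ← Set.Ioc_union_Ioi_eq_Ioi hσ.le,
    lintegral_union measurableSet_Ioi (Set.disjoint_left.2 fun x hx hx' => not_lt.2 hx.2 hx')]
  have h1 : ∫⁻ t in Set.Ioc 0 σ, P {ω | t < |X ω|} * ENNReal.ofReal (t ^ (p - 1))
      ≤ ENNReal.ofReal (σ ^ p / p) := by
    calc _ ≤ ∫⁻ t in Set.Ioc 0 σ, ENNReal.ofReal (t ^ (p - 1)) := by
          refine lintegral_mono fun t => ?_
          exact (mul_le_mul_left prob_le_one _).trans (one_mul _).le
      _ = ENNReal.ofReal (∫ t in Set.Ioc 0 σ, t ^ (p - 1)) := by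
          rw [ofReal_integral_eq_lintegral_ofReal]
          · exact (intervalIntegrable_iff_integrableOn_Ioc_of_le hσ.le).1
              (intervalIntegral.intervalIntegrable_rpow' (by linarith))
          · exact (ae_restrict_mem measurableSet_Ioc).mono fun t ht =>
              Real.rpow_nonneg ht.1.le _
      _ = _ := by
          rw [← intervalIntegral.integral_of_le hσ.le, integral_rpow (Or.inl (by linarith))]
          simp [Real.zero_rpow hp.ne']
  have h2 : ∫⁻ t in Set.Ioi σ, P {ω | t < |X ω|} * ENNReal.ofReal (t ^ (p - 1))
      ≤ ENNReal.ofReal (A * σ ^ p / (α - p)) := by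
    calc _ ≤ ∫⁻ t in Set.Ioi σ, ENNReal.ofReal (A * σ ^ α * t ^ (p - 1 - α)) := by
          refine setLIntegral_mono' measurableSet_Ioi fun t (ht : σ < t) => ?_
          have ht0 : 0 < t := hσ.trans ht
          refine (mul_le_mul_left (h t ht0) _).trans ?_
          rw [← ENNReal.ofReal_mul (by positivity), mul_assoc, ← Real.rpow_add ht0]
          ring_nf
          rfl
      _ = ENNReal.ofReal (∫ t in Set.Ioi σ, A * σ ^ α * t ^ (p - 1 - α)) := by
          rw [ofReal_integral_eq_lintegral_ofReal]
          · exact (integrableOn_Ioi_rpow_of_lt (by linarith) hσ).const_mul _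
          · refine (ae_restrict_mem measurableSet_Ioi).mono fun t (ht : σ < t) => ?_
            have ht0 : 0 < t := hσ.trans ht
            positivity
      _ = _ := by
          rw [integral_const_mul, integral_Ioi_rpow_of_lt (by linarith) hσ,
            show p - 1 - α + 1 = -(α - p) by ring, neg_div_neg_eq, ← mul_div_assoc, mul_assoc,
            ← Real.rpow_add hσ]
          ring_nf
  calc _ ≤ ENNReal.ofReal p * (ENNReal.ofReal (σ ^ p / p)
        + ENNReal.ofReal (A * σ ^ p / (α - p))) := by gcongr
    _ = _ := by
      rw [← ENNReal.ofReal_add (by positivity) (by positivity), ← ENNReal.ofReal_mul hp.le]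
      congr 1
      field_simp

/-- The `p`-th absolute moment bound of a symmetric `α`-stable law of scale `s ^ (1 / α)`. -/
theorem exists_eLpNorm_le_of_charFun {α p : ℝ} (hp : 0 < p) (hpα : p < α) :
    ∃ K : ℝ, 0 < K ∧ ∀ {Ω : Type*} [MeasurableSpace Ω] (P : Measure Ω) [IsProbabilityMeasure P]
      (s : ℝ) (X : Ω → ℝ), 0 ≤ s → AEMeasurable X P →
      (∀ θ : ℝ, charFun (P.map X) θ = ((Real.exp (-(s * |θ| ^ α)) : ℝ) : ℂ)) →
      eLpNorm X (ENNReal.ofReal p) P ≤ ENNReal.ofReal (K * s ^ (1 / α)) := by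
  have hα : 0 < α := hp.trans hpα
  have hαp : 0 < α - p := by linarith
  set M : ℝ := 1 + 2 * 2 ^ α * p / (α - p) with hM
  have hM0 : 0 < M := by positivity
  refine ⟨M ^ (1 / p), by positivity, fun P _ s X hs hX h => ?_⟩
  -- The tail estimate needs a positive scale while `s` may be `0`, so the bound is proved for every
  -- larger `σ` and then `σ` decreases to `s ^ (1 / α)`.
  have key : ∀ σ, s ^ (1 / α) < σ →
      eLpNorm X (ENNReal.ofReal p) P ≤ ENNReal.ofReal (M ^ (1 / p) * σ) := by
    intro σ hσ
    have hσ0 : 0 < σ := lt_of_le_of_lt (by positivity) hσ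
    have hsσ : s ≤ σ ^ α := by
      have := Real.rpow_le_rpow (by positivity) hσ.le hα.le
      rwa [← Real.rpow_mul hs, one_div_mul_cancel hα.ne', Real.rpow_one] at this
    have h1 := lintegral_abs_rpow_le_of_tail (P := P) (A := 2 * 2 ^ α) hp hpα (by positivity) hσ0
      hX (fun r hr => (measure_lt_abs_le_of_charFun hα.le hs hX h hr).trans
        (ENNReal.ofReal_le_ofReal (by gcongr)))
    rw [eLpNorm_eq_lintegral_rpow_enorm_toReal (by simpa using hp) ENNReal.ofReal_ne_top,
      ENNReal.toReal_ofReal hp.le]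
    have h2 : ∀ ω, ‖X ω‖ₑ ^ p = ENNReal.ofReal (|X ω| ^ p) := fun ω => by
      rw [← ofReal_norm, Real.norm_eq_abs, ENNReal.ofReal_rpow_of_nonneg (abs_nonneg _) hp.le]
    simp_rw [h2]
    refine (ENNReal.rpow_le_rpow h1 (by positivity)).trans ?_
    rw [ENNReal.ofReal_rpow_of_nonneg (by positivity) (by positivity),
      Real.mul_rpow (by positivity) hM0.le, ← Real.rpow_mul hσ0.le, mul_one_div_cancel hp.ne',
      Real.rpow_one, mul_comm]
  have hlim : Tendsto (fun σ : ℝ => ENNReal.ofReal (M ^ (1 / p) * σ)) (𝓝[>] (s ^ (1 / α)))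
      (𝓝 (ENNReal.ofReal (M ^ (1 / p) * s ^ (1 / α)))) :=
    ((ENNReal.continuous_ofReal.comp (continuous_const.mul continuous_id)).tendsto _).mono_left
      nhdsWithin_le_nhds
  exact ge_of_tendsto hlim (eventually_mem_nhdsWithin.mono fun σ hσ => key σ hσ)

/-! ### Linear combinations of increments and their step functions -/

/-- The step function `x ↦ c (1_{[x, ∞)})` attached to a functional `c` on functions of time; it is
`1_{(s, t]}` for the increment `c G = G t - G s`. -/
noncomputable def stepOf (c : (ℝ → ℝ) → ℝ) (x : ℝ) : ℝ := c ((Set.Ici x).indicator 1)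

/-- The linear combinations of increments `G ↦ G t - G s`, described through their representation
on every sufficiently fine grid. -/
noncomputable def incrComb : Submodule ℝ ((ℝ → ℝ) → ℝ) where
  -- Asking for the formula on every grid through `T` makes sums immediate: two combinations share
  -- any grid through the union of their node sets. Grids may repeat points, as those increments
  -- vanish.
  carrier := {c | ∃ T : Finset ℝ, ∀ (t : ℕ → ℝ) (n : ℕ), Monotone t →
    (∀ x ∈ T, ∃ i ≤ n, t i = x) →
    ∀ G, c G = ∑ i ∈ Finset.range n, stepOf c (t (i + 1)) * (G (t (i + 1)) - G (t i))}
  add_mem' := by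
    classical
    rintro a b ⟨T, hT⟩ ⟨U, hU⟩
    refine ⟨T ∪ U, fun t n ht h G => ?_⟩
    have ha := hT t n ht (fun x hx => h x (Finset.mem_union_left _ hx)) G
    have hb := hU t n ht (fun x hx => h x (Finset.mem_union_right _ hx)) G
    rw [Pi.add_apply, ha, hb, ← Finset.sum_add_distrib]
    exact Finset.sum_congr rfl fun i _ => by simp only [stepOf, Pi.add_apply]; ring
  zero_mem' := ⟨∅, fun t n _ _ G => by simp [stepOf]⟩
  smul_mem' := by
    rintro r a ⟨T, hT⟩
    refine ⟨T, fun t n ht h G => ?_⟩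
    rw [Pi.smul_apply, hT t n ht h G, smul_eq_mul, Finset.mul_sum]
    exact Finset.sum_congr rfl fun i _ => by simp only [stepOf, Pi.smul_apply, smul_eq_mul]; ring

theorem stepOf_sub_apply (s u x : ℝ) (hsu : s ≤ u) :
    stepOf (fun G => G u - G s) x = (Set.Ioc s u).indicator (fun _ => 1) x := by
  simp only [stepOf, Set.indicator_apply, Set.mem_Ici, Set.mem_Ioc, Pi.one_apply]
  split_ifs <;> grind

theorem increment_mem_incrComb {s u : ℝ} (hsu : s ≤ u) :
    (fun G : ℝ → ℝ => G u - G s) ∈ incrComb := by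
  refine ⟨{s, u}, fun t n ht h G => ?_⟩
  obtain ⟨a, ha, rfl⟩ := h s (by simp)
  obtain ⟨b, hb, rfl⟩ := h u (by simp)
  simp_rw [stepOf_sub_apply _ _ _ hsu]
  -- Grids are only weakly monotone, so the indices can come in the wrong order; then the two nodes
  -- coincide and everything is zero.
  wlog hab : a ≤ b generalizing a b
  · have hts : t a = t b := le_antisymm hsu (ht (not_le.1 hab).le)
    simp [hts]
  have : ∀ i ∈ Finset.range n, (Set.Ioc (t a) (t b)).indicator (fun _ => (1 : ℝ)) (t (i + 1)) *
      (G (t (i + 1)) - G (t i)) = if i ∈ Finset.Ico a b then G (t (i + 1)) - G (t i) else 0 := by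
    intro i _
    simp only [Set.indicator_apply, Set.mem_Ioc, Finset.mem_Ico]
    have hi := ht (Nat.le_succ i)
    by_cases h1 : a ≤ i
    · have h3 := ht h1
      by_cases h2 : i < b
      · have h4 : t (i + 1) ≤ t b := ht h2
        rcases (h3.trans hi).lt_or_eq with h5 | h5
        · simp [h1, h2, h4, h5]
        · have : t i = t (i + 1) := le_antisymm hi (by rw [← h5]; exact h3)
          simp [this]
      · have h4 : t b ≤ t i := ht (not_lt.1 h2)
        by_cases h6 : t (i + 1) ≤ t b
        · have : t i = t (i + 1) := le_antisymm hi (h6.trans h4)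
          simp [this]
        · simp [h2, h6]
    · have h3 : t (i + 1) ≤ t a := ht (by omega)
      simp [h1, not_lt.2 h3]
  rw [Finset.sum_congr rfl this, ← Finset.sum_filter, Finset.filter_mem_eq_inter,
    Finset.inter_eq_right.2, Finset.sum_Ico_sub (fun i => G (t i)) hab]
  intro i hi
  simp only [Finset.mem_Ico, Finset.mem_range] at *
  omega

theorem exists_grid (T : Finset ℝ) :
    ∃ (t : ℕ → ℝ) (n : ℕ), Monotone t ∧ ∀ x ∈ T, ∃ i ≤ n, t i = x := by
  rcases T.eq_empty_or_nonempty with rfl | hT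
  · exact ⟨fun _ => 0, 0, monotone_const, by simp⟩
  have hpos : 0 < T.card := Finset.card_pos.2 hT
  -- The increasing enumeration of `T` is continued by its largest point, to be monotone on all of
  -- `ℕ`.
  refine ⟨fun i => T.orderEmbOfFin rfl ⟨min i (T.card - 1), by omega⟩, T.card, ?_, fun x hx => ?_⟩
  · intro i j hij
    refine (T.orderEmbOfFin rfl).monotone ?_
    simp only [Fin.mk_le_mk]
    omega
  · have : x ∈ Set.range (T.orderEmbOfFin rfl) := by simpa using hx
    obtain ⟨i, rfl⟩ := this
    refine ⟨i, i.2.le, ?_⟩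
    have hi : (⟨min i (T.card - 1), by omega⟩ : Fin T.card) = i := Fin.ext (by simp only; omega)
    simp only [hi]

/-- A combination of increments is a combination of consecutive increments along a grid. -/
theorem exists_grid_repr {c : (ℝ → ℝ) → ℝ} (hc : c ∈ incrComb) :
    ∃ (t : ℕ → ℝ) (n : ℕ) (a : ℕ → ℝ), Monotone t ∧
      ∀ G, c G = ∑ i ∈ Finset.range n, a i * (G (t (i + 1)) - G (t i)) := by
  obtain ⟨T, hT⟩ := hc
  obtain ⟨t, n, ht, h⟩ := exists_grid T
  exact ⟨t, n, _, ht, hT t n ht h⟩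

theorem stepOf_eq_of_repr {c : (ℝ → ℝ) → ℝ} {t a : ℕ → ℝ} {n : ℕ} (ht : Monotone t)
    (hc : ∀ G, c G = ∑ i ∈ Finset.range n, a i * (G (t (i + 1)) - G (t i))) :
    stepOf c = fun x =>
      ∑ i ∈ Finset.range n, (Set.Ioc (t i) (t (i + 1))).indicator (fun _ => a i) x := by
  ext x
  rw [stepOf, hc]
  refine Finset.sum_congr rfl fun i _ => ?_
  have := stepOf_sub_apply (t i) (t (i + 1)) x (ht (Nat.le_succ i))
  rw [stepOf] at this
  rw [this]
  simp [Set.indicator_apply]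

/-- The cells are disjoint, so at each point at most one term survives and the power passes inside
the sum. -/
theorem lintegral_rpow_sum_indicator_Ioc {t : ℕ → ℝ} (ht : Monotone t) (a : ℕ → ℝ) (n : ℕ)
    {α : ℝ} (hα : 0 < α) :
    ∫⁻ x, ‖∑ i ∈ Finset.range n, (Set.Ioc (t i) (t (i + 1))).indicator (fun _ => a i) x‖ₑ ^ α
      = ENNReal.ofReal (∑ i ∈ Finset.range n, |a i| ^ α * (t (i + 1) - t i)) := by
  have hdisj := ht.pairwise_disjoint_on_Ioc_succ
  have hpt : ∀ x,
      ‖∑ i ∈ Finset.range n, (Set.Ioc (t i) (t (i + 1))).indicator (fun _ => a i) x‖ₑ ^ α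
      = ∑ i ∈ Finset.range n,
        (Set.Ioc (t i) (t (i + 1))).indicator (fun _ => ENNReal.ofReal (|a i| ^ α)) x := by
    intro x
    by_cases hx : ∃ i ∈ Finset.range n, x ∈ Set.Ioc (t i) (t (i + 1))
    · obtain ⟨i, hi, hxi⟩ := hx
      have hne : ∀ j, j ≠ i → x ∉ Set.Ioc (t j) (t (j + 1)) := fun j hj hxj =>
        Set.disjoint_left.1 (hdisj hj) hxj hxi
      rw [Finset.sum_eq_single_of_mem i hi
          (fun j _ hj => Set.indicator_of_notMem (hne j hj) _),
        Finset.sum_eq_single_of_mem i hi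
          (fun j _ hj => Set.indicator_of_notMem (hne j hj) _),
        Set.indicator_of_mem hxi, Set.indicator_of_mem hxi, ← ofReal_norm, Real.norm_eq_abs,
        ENNReal.ofReal_rpow_of_nonneg (abs_nonneg _) hα.le]
    · push Not at hx
      rw [Finset.sum_eq_zero (fun i hi => Set.indicator_of_notMem (hx i hi) _),
        Finset.sum_eq_zero (fun i hi => Set.indicator_of_notMem (hx i hi) _)]
      simp [hα]
  simp_rw [hpt]
  rw [lintegral_finsetSum _ (fun i _ => measurable_const.indicator measurableSet_Ioc),
    ENNReal.ofReal_sum_of_nonneg]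
  · refine Finset.sum_congr rfl fun i _ => ?_
    rw [lintegral_indicator_const measurableSet_Ioc, Real.volume_Ioc,
      ENNReal.ofReal_mul (by positivity)]
  · intro i _
    have := ht (Nat.le_succ i)
    exact mul_nonneg (by positivity) (sub_nonneg.2 this)

theorem measurable_stepOf {c : (ℝ → ℝ) → ℝ} (hc : c ∈ incrComb) : Measurable (stepOf c) := by
  obtain ⟨t, n, a, ht, h⟩ := exists_grid_repr hc
  rw [stepOf_eq_of_repr ht h]
  exact Finset.measurable_sum _ fun i _ => measurable_const.indicator measurableSet_Ioc

theorem memLp_stepOf {c : (ℝ → ℝ) → ℝ} (hc : c ∈ incrComb) (q : ENNReal) :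
    MemLp (stepOf c) q volume := by
  obtain ⟨t, n, a, ht, h⟩ := exists_grid_repr hc
  rw [stepOf_eq_of_repr ht h]
  exact memLp_finsetSum _ fun i _ => memLp_indicator_const _ measurableSet_Ioc _ (Or.inr (by simp))

/-! ### Elementary integrals against the stable process -/

section

variable {Ω : Type*} [MeasurableSpace Ω] {P : Measure Ω} {α : ℝ} {L : ℝ → Ω → ℝ}

theorem IsSaSLevyMotion.measurable_comb (hL : IsSaSLevyMotion P α L) {c : (ℝ → ℝ) → ℝ}
    (hc : c ∈ incrComb) : Measurable fun ω => c fun t => L t ω := by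
  obtain ⟨t, n, a, ht, h⟩ := exists_grid_repr hc
  simp_rw [h]
  exact Finset.measurable_sum _ fun i _ =>
    measurable_const.mul ((hL.measurable _).sub (hL.measurable _))

/-- A combination of increments of the stable process is a symmetric stable variable whose scale
is the `L^α` norm of the attached step function. -/
theorem IsSaSLevyMotion.charFun_comb (hL : IsSaSLevyMotion P α L) (hα : 0 < α)
    {c : (ℝ → ℝ) → ℝ} (hc : c ∈ incrComb) :
    ∃ s : ℝ, 0 ≤ s ∧
      eLpNorm (stepOf c) (ENNReal.ofReal α) volume = ENNReal.ofReal (s ^ (1 / α)) ∧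
      ∀ θ : ℝ, charFun (P.map fun ω => c fun t => L t ω) θ
        = ((Real.exp (-(s * |θ| ^ α)) : ℝ) : ℂ) := by
  obtain ⟨t, n, a, ht, h⟩ := exists_grid_repr hc
  have hs : 0 ≤ ∑ i ∈ Finset.range n, |a i| ^ α * (t (i + 1) - t i) :=
    Finset.sum_nonneg fun i _ => mul_nonneg (by positivity) (sub_nonneg.2 (ht (Nat.le_succ i)))
  refine ⟨_, hs, ?_, fun θ => ?_⟩
  · rw [eLpNorm_eq_lintegral_rpow_enorm_toReal (by simpa using hα) ENNReal.ofReal_ne_top,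
      ENNReal.toReal_ofReal hα.le, stepOf_eq_of_repr ht h,
      lintegral_rpow_sum_indicator_Ioc ht a n hα,
      ENNReal.ofReal_rpow_of_nonneg hs (by positivity)]
  · have hind : iIndepFun (fun i ω => a i * (L (t (i + 1)) ω - L (t i) ω)) P :=
      (hL.indep.nat ht).comp (fun i x => a i * x) fun i => measurable_const_mul _
    simp_rw [h]
    have hmeas : ∀ i ∈ Finset.range n,
        AEMeasurable (fun ω => a i * (L (t (i + 1)) ω - L (t i) ω)) P := fun i _ =>
      (measurable_const.mul ((hL.measurable _).sub (hL.measurable _))).aemeasurable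
    rw [iIndepFun.charFun_map_fun_finsetSum_eq_prod hmeas (hind.restrict _), Finset.prod_apply]
    have hfac : ∀ i, charFun (P.map fun ω => a i * (L (t (i + 1)) ω - L (t i) ω)) θ
        = ((Real.exp (-(|a i| ^ α * (t (i + 1) - t i) * |θ| ^ α)) : ℝ) : ℂ) := by
      intro i
      have hincr : AEMeasurable (fun ω => L (t (i + 1)) ω - L (t i) ω) P :=
        ((hL.measurable _).sub (hL.measurable _)).aemeasurable
      rw [charFun_map_mul_comp hincr, hL.charFun_increment _ _ (ht (Nat.le_succ i)), abs_mul,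
        Real.mul_rpow (abs_nonneg _) (abs_nonneg _)]
      congr 3
      ring
    simp_rw [hfac]
    rw [← Complex.ofReal_prod, ← Real.exp_sum, Finset.sum_neg_distrib, Finset.sum_mul]

/-- The constant does not depend on `c`; this is the continuity estimate through which the integral
extends from step functions to `L^α`. -/
theorem IsSaSLevyMotion.exists_eLpNorm_comb_le [IsProbabilityMeasure P]
    (hL : IsSaSLevyMotion P α L) {p : ℝ} (hp : 0 < p) (hpα : p < α) :
    ∃ K : NNReal, ∀ c ∈ incrComb,
      eLpNorm (fun ω => c fun t => L t ω) (ENNReal.ofReal p) P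
        ≤ K * eLpNorm (stepOf c) (ENNReal.ofReal α) volume := by
  obtain ⟨K, hK, h⟩ := exists_eLpNorm_le_of_charFun hp hpα
  refine ⟨K.toNNReal, fun c hc => ?_⟩
  obtain ⟨s, hs, h1, h2⟩ := hL.charFun_comb (hp.trans hpα) hc
  rw [h1, show ((K.toNNReal : NNReal) : ENNReal) = ENNReal.ofReal K from rfl,
    ← ENNReal.ofReal_mul hK.le]
  exact h P s _ hs (hL.measurable_comb hc).aemeasurable h2

theorem IsSaSLevyMotion.memLp_comb [IsProbabilityMeasure P]
    (hL : IsSaSLevyMotion P α L) {p : ℝ} (hp : 0 < p) (hpα : p < α) {c : (ℝ → ℝ) → ℝ}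
    (hc : c ∈ incrComb) : MemLp (fun ω => c fun t => L t ω) (ENNReal.ofReal p) P := by
  obtain ⟨K, h⟩ := hL.exists_eLpNorm_comb_le hp hpα
  exact ⟨(hL.measurable_comb hc).aestronglyMeasurable, (h c hc).trans_lt
    (ENNReal.mul_lt_top ENNReal.coe_lt_top (memLp_stepOf hc _).2)⟩

end

/-! ### Density of step functions -/

/-- The combination of increments `∑ i, a i * (G (t (i+1)) - G (t i))` of a step function. -/
def StepFun.comb (φ : StepFun) (G : ℝ → ℝ) : ℝ :=
  ∑ i, φ.a i * (G (φ.t i.succ) - G (φ.t i.castSucc))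

theorem StepFun.comb_mem (φ : StepFun) : φ.comb ∈ incrComb := by
  have : φ.comb = ∑ i, φ.a i • fun G : ℝ → ℝ => G (φ.t i.succ) - G (φ.t i.castSucc) := by
    ext G
    simp [StepFun.comb, Finset.sum_apply]
  rw [this]
  exact Submodule.sum_mem _ fun i _ => Submodule.smul_mem _ _
    (increment_mem_incrComb (φ.strictMono_t (Fin.castSucc_lt_succ)).le)

theorem StepFun.stepOf_comb (φ : StepFun) : stepOf φ.comb = φ.toFun := by
  ext x
  rw [stepOf, StepFun.comb, StepFun.toFun]
  refine Finset.sum_congr rfl fun i _ => ?_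
  have := stepOf_sub_apply (φ.t i.castSucc) (φ.t i.succ) x
    (φ.strictMono_t (Fin.castSucc_lt_succ)).le
  rw [stepOf] at this
  rw [this]
  simp [Set.indicator_apply]

theorem stepOf_sub (c c' : (ℝ → ℝ) → ℝ) : stepOf (c - c') = stepOf c - stepOf c' := rfl

theorem stepOf_sum {ι : Type*} (s : Finset ι) (c : ι → (ℝ → ℝ) → ℝ) :
    stepOf (∑ i ∈ s, c i) = ∑ i ∈ s, stepOf (c i) := by
  ext x
  simp [stepOf, Finset.sum_apply]

/-- The step function taking the values of `h` at the right end points of the subdivision of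
`(-M, M]` into `N` equal intervals. -/
noncomputable def StepFun.sample (h : ℝ → ℝ) (M : ℝ) (N : ℕ) (hM : 0 < M) (hN : 0 < N) :
    StepFun where
  n := N
  t i := -M + i * (2 * M / N)
  a i := h (-M + ((i : ℕ) + 1) * (2 * M / N))
  strictMono_t i j hij := by
    have h1 : (i : ℝ) < j := by exact_mod_cast hij
    have h2 : 0 < 2 * M / N := by positivity
    nlinarith [mul_lt_mul_of_pos_right h1 h2]

/-- Within a cell, `x` is closer than `δ` to the right end point where `h` is sampled; outside `(-M,
M]` both functions vanish. -/
theorem StepFun.abs_toFun_sample_sub_le {h : ℝ → ℝ} {M ε δ : ℝ} {N : ℕ} (hM : 0 < M) (hN : 0 < N)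
    (hδ : 2 * M / N < δ) (hh : ∀ x y, dist x y < δ → dist (h x) (h y) ≤ ε)
    (h0 : ∀ x, x ∉ Set.Ioc (-M) M → h x = 0) (x : ℝ) :
    |(StepFun.sample h M N hM hN).toFun x - h x|
      ≤ (Set.Ioc (-M) M).indicator (fun _ => ε) x := by
  set t : ℕ → ℝ := fun i => -M + i * (2 * M / N) with ht_def
  have hstep : 0 < 2 * M / N := by positivity
  have ht : Monotone t := fun i j hij => by
    have h1 : (i : ℝ) ≤ j := by exact_mod_cast hij
    simp only [ht_def]
    nlinarith
  have hsum : (StepFun.sample h M N hM hN).toFun x = ∑ i ∈ Finset.range N,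
      (Set.Ioc (t i) (t (i + 1))).indicator (fun _ => h (t (i + 1))) x := by
    rw [← Fin.sum_univ_eq_sum_range
      (fun i => (Set.Ioc (t i) (t (i + 1))).indicator (fun _ => h (t (i + 1))) x)]
    simp [StepFun.toFun, StepFun.sample, ht_def]
    rfl
  have hcover := ht.biUnion_Ico_Ioc_map_succ 0 N
  have htN : t N = M := by
    simp only [ht_def]; field_simp; ring
  have ht0 : t 0 = -M := by simp [ht_def]
  rw [ht0, htN] at hcover
  rw [hsum]
  by_cases hx : x ∈ Set.Ioc (-M) M
  · rw [Set.indicator_of_mem hx]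
    rw [← hcover] at hx
    simp only [Set.mem_iUnion, Set.mem_Ico, Nat.succ_eq_succ, Nat.succ_eq_add_one] at hx
    obtain ⟨i, ⟨-, hi⟩, hxi⟩ := hx
    have hxi' : x ∈ Set.Ioc (t i) (t (i + 1)) := hxi
    rw [Finset.sum_eq_single_of_mem i (Finset.mem_range.2 hi), Set.indicator_of_mem hxi',
      ← Real.dist_eq]
    · refine hh _ _ ?_
      have h1 : t (i + 1) - t i = 2 * M / N := by simp only [ht_def]; push_cast; ring
      rw [Real.dist_eq, abs_of_nonneg (by linarith [hxi'.2])]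
      linarith [hxi'.1]
    · intro j _ hj
      refine Set.indicator_of_notMem (fun hxj => ?_) _
      exact Set.disjoint_left.1 (ht.pairwise_disjoint_on_Ioc_succ hj) hxj hxi'
  · rw [Set.indicator_of_notMem hx, h0 x hx, Finset.sum_eq_zero]
    · simp
    · intro i hi
      refine Set.indicator_of_notMem (fun hxi => hx ?_) _
      rw [← ht0, ← htN]
      exact ⟨(ht (Nat.zero_le _)).trans_lt hxi.1,
        hxi.2.trans (ht (by simpa [Nat.succ_le_iff] using hi))⟩

/-- Step functions are dense in `L^p(ℝ)`. -/
theorem MeasureTheory.MemLp.exists_stepFun_eLpNorm_sub_le {f : ℝ → ℝ} {q : ENNReal} (hq1 : 1 ≤ q)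
    (hq : q ≠ ⊤) (hf : MemLp f q volume) {ε : ENNReal} (hε : ε ≠ 0) :
    ∃ φ : StepFun, eLpNorm (φ.toFun - f) q volume ≤ ε := by
  obtain ⟨h, hsupp, hfh, hcont, hmem⟩ := hf.exists_hasCompactSupport_eLpNorm_sub_le hq
    (ENNReal.half_pos hε).ne'
  have hunif := hcont.uniformContinuous_of_tendsto_cocompact hsupp.is_zero_at_infty
  obtain ⟨R, hR⟩ := hsupp.isCompact.isBounded.subset_closedBall 0
  set M : ℝ := |R| + 1
  have hM : 0 < M := by positivity
  have h0 : ∀ x, x ∉ Set.Ioc (-M) M → h x = 0 := by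
    intro x hx
    by_contra hne
    have := hR (subset_tsupport _ hne)
    rw [mem_closedBall_zero_iff, Real.norm_eq_abs] at this
    have h1 := abs_le.1 (this.trans (le_abs_self R))
    exact hx ⟨by simp only [M]; linarith [h1.1], by simp only [M]; linarith [h1.2]⟩
  have hvol : volume (Set.Ioc (-M) M) ^ (1 / q.toReal) ≠ ⊤ := by
    rw [Real.volume_Ioc]
    exact ENNReal.rpow_ne_top_of_nonneg (by positivity) ENNReal.ofReal_ne_top
  -- A uniform error `η` on `(-M, M]` costs `η (2M)^(1/q)` in `L^q`, which is to stay below `ε / 2`.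
  obtain ⟨η, hη0, hη⟩ := ENNReal.exists_nnreal_pos_mul_lt hvol (ENNReal.half_pos hε).ne'
  obtain ⟨δ, hδ0, hδ⟩ := Metric.uniformContinuous_iff.1 hunif η (by exact_mod_cast hη0)
  obtain ⟨N, hN⟩ := exists_nat_gt (2 * M / δ)
  have hN0 : 0 < N := by
    have : (0 : ℝ) < N := lt_of_le_of_lt (by positivity) hN
    exact_mod_cast this
  have hNδ : 2 * M / N < δ := by
    rw [div_lt_iff₀ (by exact_mod_cast hN0)]
    rwa [div_lt_iff₀' hδ0] at hN
  have key := StepFun.abs_toFun_sample_sub_le hM hN0 hNδ (fun x y hxy => (hδ hxy).le) h0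
  set φ := StepFun.sample h M N hM hN0
  have h1 : eLpNorm (φ.toFun - h) q volume ≤ ε / 2 := by
    refine (eLpNorm_mono_real key).trans ?_
    refine (eLpNorm_indicator_const_le _ _).trans ?_
    rw [Real.enorm_of_nonneg η.coe_nonneg, ENNReal.ofReal_coe_nnreal]
    exact hη.le
  have hφ : AEStronglyMeasurable φ.toFun volume := by
    rw [← φ.stepOf_comb]
    exact (measurable_stepOf φ.comb_mem).aestronglyMeasurable
  refine ⟨φ, ?_⟩
  calc eLpNorm (φ.toFun - f) q volume = eLpNorm ((φ.toFun - h) - (f - h)) q volume := by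
        congr 1; ring
    _ ≤ eLpNorm (φ.toFun - h) q volume + eLpNorm (f - h) q volume :=
        eLpNorm_sub_le (hφ.sub hmem.1) (hf.1.sub hmem.1) hq1
    _ ≤ ε / 2 + ε / 2 := add_le_add h1 hfh
    _ = ε := ENNReal.add_halves ε

/-! ### The stable integral as an `L^p` limit -/

section

variable {Ω : Type*} [MeasurableSpace Ω] {P : Measure Ω} {α : ℝ} {L : ℝ → Ω → ℝ}

/-- The elementary integrals along step functions converging in `L^α` converge in `L^p`, and the
limit does not depend on the step functions. -/
theorem IsSaSLevyMotion.exists_tendsto_eLpNorm_comb [IsProbabilityMeasure P]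
    (hL : IsSaSLevyMotion P α L) {p : ℝ} (hp : 1 ≤ p) (hpα : p < α) {f : ℝ → ℝ}
    (hf : MemLp f (ENNReal.ofReal α) volume) :
    ∃ X : Ω → ℝ, MemLp X (ENNReal.ofReal p) P ∧ ∀ c : ℕ → (ℝ → ℝ) → ℝ, (∀ k, c k ∈ incrComb) →
      Tendsto (fun k => eLpNorm (stepOf (c k) - f) (ENNReal.ofReal α) volume) atTop (𝓝 0) →
      Tendsto (fun k => eLpNorm ((fun ω => c k fun t => L t ω) - X) (ENNReal.ofReal p) P)
        atTop (𝓝 0) := by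
  have hp0 : 0 < p := by linarith
  have hp1 : 1 ≤ ENNReal.ofReal p := by simpa using hp
  have hα1 : 1 ≤ ENNReal.ofReal α := by simpa using hp.trans hpα.le
  obtain ⟨K, hK⟩ := hL.exists_eLpNorm_comb_le hp0 hpα
  have hsub : ∀ c ∈ incrComb, ∀ c' ∈ incrComb,
      eLpNorm ((fun ω => c fun t => L t ω) - fun ω => c' fun t => L t ω) (ENNReal.ofReal p) P
        ≤ K * (eLpNorm (stepOf c - f) (ENNReal.ofReal α) volume
          + eLpNorm (stepOf c' - f) (ENNReal.ofReal α) volume) := by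
    intro c hc c' hc'
    refine (hK _ (Submodule.sub_mem _ hc hc')).trans ?_
    gcongr
    rw [stepOf_sub, ← sub_sub_sub_cancel_right _ _ f]
    exact eLpNorm_sub_le ((measurable_stepOf hc).aestronglyMeasurable.sub hf.1)
      ((measurable_stepOf hc').aestronglyMeasurable.sub hf.1) hα1
  -- With `2 K δ < 1`, step functions within `δ 2⁻ᴺ` of `f` have integrals within `2⁻ᴺ` of one
  -- another, a summable Cauchy rate.
  obtain ⟨δ, hδ0, hδ⟩ := ENNReal.exists_nnreal_pos_mul_lt
    (show (K : ENNReal) * 2 ≠ ⊤ from ENNReal.mul_ne_top ENNReal.coe_ne_top (by simp))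
    (one_ne_zero)
  have hB : ∀ N : ℕ, (2⁻¹ : ENNReal) ^ N ≠ 0 := fun N => by simp
  have hBt : ∀ N : ℕ, (2⁻¹ : ENNReal) ^ N ≠ ⊤ := fun N => by simp
  choose φ hφ using fun N : ℕ => hf.exists_stepFun_eLpNorm_sub_le hα1 ENNReal.ofReal_ne_top
    (ε := δ * 2⁻¹ ^ N) (mul_ne_zero (by exact_mod_cast hδ0.ne') (hB N))
  have hφ' : ∀ N n, N ≤ n → eLpNorm (stepOf (φ n).comb - f) (ENNReal.ofReal α) volume
      ≤ δ * 2⁻¹ ^ N := by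
    intro N n hn
    rw [(φ n).stepOf_comb]
    refine (hφ n).trans ?_
    exact mul_le_mul' le_rfl (pow_le_pow_of_le_one zero_le (ENNReal.inv_le_one.2 one_le_two) hn)
  obtain ⟨X, hX, hlim⟩ := Lp.cauchy_complete_eLpNorm (μ := P) hp1
    (f := fun n ω => (φ n).comb fun t => L t ω)
    (fun n => hL.memLp_comb hp0 hpα (φ n).comb_mem) (B := fun N => 2⁻¹ ^ N)
    (by rw [ENNReal.tsum_geometric]; simp) (by
      intro N n m hn hm
      refine (hsub _ (φ n).comb_mem _ (φ m).comb_mem).trans_lt ?_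
      calc _ ≤ (K : ENNReal) * (δ * 2⁻¹ ^ N + δ * 2⁻¹ ^ N) := by
            gcongr
            exacts [hφ' N n hn, hφ' N m hm]
        _ = (δ * (K * 2)) * 2⁻¹ ^ N := by ring
        _ < 1 * 2⁻¹ ^ N := ENNReal.mul_lt_mul_left (hB N) (hBt N) hδ
        _ = _ := one_mul _)
  refine ⟨X, hX, fun c hc hcf => ?_⟩
  have hφf : Tendsto (fun k => eLpNorm (stepOf (φ k).comb - f) (ENNReal.ofReal α) volume)
      atTop (𝓝 0) := by
    refine tendsto_of_tendsto_of_tendsto_of_le_of_le tendsto_const_nhds (?_ : Tendsto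
      (fun k : ℕ => (δ : ENNReal) * 2⁻¹ ^ k) atTop (𝓝 0)) (fun _ => zero_le)
      (fun k => hφ' k k le_rfl)
    have := ENNReal.Tendsto.const_mul (a := (δ : ENNReal))
      (ENNReal.tendsto_pow_atTop_nhds_zero_of_lt_one (r := 2⁻¹) (by simp))
      (Or.inr ENNReal.coe_ne_top)
    simpa using this
  have hbound : Tendsto (fun k => (K : ENNReal) *
      (eLpNorm (stepOf (c k) - f) (ENNReal.ofReal α) volume
        + eLpNorm (stepOf (φ k).comb - f) (ENNReal.ofReal α) volume)
      + eLpNorm ((fun ω => (φ k).comb fun t => L t ω) - X) (ENNReal.ofReal p) P)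
      atTop (𝓝 0) := by
    have := (ENNReal.Tendsto.const_mul (a := (K : ENNReal)) (hcf.add hφf)
      (Or.inr ENNReal.coe_ne_top)).add hlim
    simpa using this
  refine tendsto_of_tendsto_of_tendsto_of_le_of_le tendsto_const_nhds hbound
    (fun _ => zero_le) (fun k => ?_)
  simp only
  -- An arbitrary approximating sequence is compared with the fixed one that defines `X`.
  rw [← sub_add_sub_cancel _ (fun ω => (φ k).comb fun t => L t ω) X]
  have hm := (hL.memLp_comb hp0 hpα (φ k).comb_mem).1
  exact (eLpNorm_add_le ((hL.memLp_comb hp0 hpα (hc k)).1.sub hm) (hm.sub hX.1) hp1).trans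
    (add_le_add_left (hsub _ (hc k) _ (φ k).comb_mem) _)

/-- Every `f ∈ L^α(ℝ)` has a stable stochastic integral; it lies in `L^p` for `1 ≤ p < α` and is
the `L^p` limit of elementary integrals. -/
theorem IsSaSLevyMotion.stableIntegral_spec [IsProbabilityMeasure P]
    (hL : IsSaSLevyMotion P α L) {p : ℝ} (hp : 1 ≤ p) (hpα : p < α) {f : ℝ → ℝ}
    (hf : MemLp f (ENNReal.ofReal α) volume) :
    IsStableIntegral P α L f (stableIntegral P α L f) ∧
    MemLp (stableIntegral P α L f) (ENNReal.ofReal p) P ∧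
    ∀ c : ℕ → (ℝ → ℝ) → ℝ, (∀ k, c k ∈ incrComb) →
      Tendsto (fun k => eLpNorm (stepOf (c k) - f) (ENNReal.ofReal α) volume) atTop (𝓝 0) →
      Tendsto (fun k => eLpNorm ((fun ω => c k fun t => L t ω) - stableIntegral P α L f)
        (ENNReal.ofReal p) P) atTop (𝓝 0) := by
  have hp0 : 0 < p := by linarith
  obtain ⟨X, hX, hconv⟩ := hL.exists_tendsto_eLpNorm_comb hp hpα hf
  have hXint : IsStableIntegral P α L f X := by
    refine ⟨hf, hX.1.aemeasurable, fun φ hφ => ?_⟩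
    refine tendstoInMeasure_of_tendsto_eLpNorm (p := ENNReal.ofReal p) (by simpa using hp0)
      (fun k => (hL.memLp_comb hp0 hpα (φ k).comb_mem).1) hX.1
      (hconv (fun k => (φ k).comb) (fun k => (φ k).comb_mem) ?_)
    simp_rw [StepFun.stepOf_comb]
    exact hφ
  have hex : ∃ X, IsStableIntegral P α L f X := ⟨X, hXint⟩
  have hspec : IsStableIntegral P α L f (stableIntegral P α L f) := by
    rw [stableIntegral, dif_pos hex]
    exact hex.choose_spec
  -- The chosen version need not be `X` itself, but both are limits in measure of the same
  -- elementary integrals.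
  have hae : stableIntegral P α L f =ᵐ[P] X := by
    choose φ hφ using fun N : ℕ => hf.exists_stepFun_eLpNorm_sub_le
      (by simpa using hp.trans hpα.le) ENNReal.ofReal_ne_top
      (ε := 2⁻¹ ^ N) (by simp)
    have hφ0 : Tendsto (fun k => eLpNorm (fun x => (φ k).toFun x - f x) (ENNReal.ofReal α) volume)
        atTop (𝓝 0) :=
      tendsto_of_tendsto_of_tendsto_of_le_of_le tendsto_const_nhds
        (ENNReal.tendsto_pow_atTop_nhds_zero_of_lt_one (r := 2⁻¹) (by simp))
        (fun _ => zero_le) hφ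
    exact tendstoInMeasure_ae_unique (hspec.2.2 φ hφ0) (hXint.2.2 φ hφ0)
  refine ⟨hspec, hX.ae_eq hae.symm, fun c hc hcf => ?_⟩
  refine (hconv c hc hcf).congr fun k => eLpNorm_congr_ae ?_
  exact (EventuallyEq.refl _ _).sub hae.symm

/-- Sums of stable integrals are controlled in `L^p` by the `L^α` norm of the sum of the
integrands. -/
theorem IsSaSLevyMotion.exists_eLpNorm_sum_stableIntegral_le [IsProbabilityMeasure P]
    (hL : IsSaSLevyMotion P α L) {p : ℝ} (hp : 1 ≤ p) (hpα : p < α) :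
    ∃ K : NNReal, ∀ {ι : Type} (s : Finset ι) (f : ι → ℝ → ℝ),
      (∀ i ∈ s, MemLp (f i) (ENNReal.ofReal α) volume) →
      eLpNorm (∑ i ∈ s, stableIntegral P α L (f i)) (ENNReal.ofReal p) P
        ≤ K * eLpNorm (∑ i ∈ s, f i) (ENNReal.ofReal α) volume := by
  have hp0 : 0 < p := by linarith
  have hp1 : 1 ≤ ENNReal.ofReal p := by simpa using hp
  have hα1 : 1 ≤ ENNReal.ofReal α := by simpa using hp.trans hpα.le
  obtain ⟨K, hK⟩ := hL.exists_eLpNorm_comb_le hp0 hpα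
  refine ⟨K, fun {ι} s f hf => ?_⟩
  have happ : ∀ i, ∃ φ : ℕ → StepFun, i ∈ s → ∀ k,
      eLpNorm ((φ k).toFun - f i) (ENNReal.ofReal α) volume ≤ 2⁻¹ ^ k := by
    intro i
    by_cases hi : i ∈ s
    · choose φ hφ using fun N : ℕ => (hf i hi).exists_stepFun_eLpNorm_sub_le hα1
        ENNReal.ofReal_ne_top (ε := 2⁻¹ ^ N) (by simp)
      exact ⟨φ, fun _ => hφ⟩
    · exact ⟨fun _ => StepFun.sample 0 1 1 one_pos one_pos, fun h => absurd h hi⟩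
  choose φ hφ using happ
  have hf_lim : ∀ i ∈ s, Tendsto (fun k => eLpNorm (stepOf (φ i k).comb - f i)
      (ENNReal.ofReal α) volume) atTop (𝓝 0) := fun i hi => by
    simp_rw [StepFun.stepOf_comb]
    exact tendsto_of_tendsto_of_tendsto_of_le_of_le tendsto_const_nhds
      (ENNReal.tendsto_pow_atTop_nhds_zero_of_lt_one (r := 2⁻¹) (by simp))
      (fun _ => zero_le) (hφ i hi)
  have hX_lim : ∀ i ∈ s, Tendsto (fun k => eLpNorm ((fun ω => (φ i k).comb fun t => L t ω)
      - stableIntegral P α L (f i)) (ENNReal.ofReal p) P) atTop (𝓝 0) := fun i hi =>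
    (hL.stableIntegral_spec hp hpα (hf i hi)).2.2 _ (fun k => (φ i k).comb_mem) (hf_lim i hi)
  have hmemX : ∀ i ∈ s, AEStronglyMeasurable (stableIntegral P α L (f i)) P := fun i hi =>
    (hL.stableIntegral_spec hp hpα (hf i hi)).2.1.1
  have hmemI : ∀ i k, AEStronglyMeasurable (fun ω => (φ i k).comb fun t => L t ω) P := fun i k =>
    (hL.memLp_comb hp0 hpα (φ i k).comb_mem).1
  have hmemS : ∀ i k, AEStronglyMeasurable (stepOf (φ i k).comb) volume := fun i k =>
    (measurable_stepOf (φ i k).comb_mem).aestronglyMeasurable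
  have hlim : Tendsto (fun k =>
      ∑ i ∈ s, eLpNorm ((fun ω => (φ i k).comb fun t => L t ω)
        - stableIntegral P α L (f i)) (ENNReal.ofReal p) P
      + K * (∑ i ∈ s, eLpNorm (stepOf (φ i k).comb - f i) (ENNReal.ofReal α) volume
        + eLpNorm (∑ i ∈ s, f i) (ENNReal.ofReal α) volume)) atTop
      (𝓝 (K * eLpNorm (∑ i ∈ s, f i) (ENNReal.ofReal α) volume)) := by
    have := (tendsto_finsetSum s hX_lim).add (ENNReal.Tendsto.const_mul (a := (K : ENNReal))
      ((tendsto_finsetSum s hf_lim).add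
        (tendsto_const_nhds (x := eLpNorm (∑ i ∈ s, f i) (ENNReal.ofReal α) volume)))
      (Or.inr ENNReal.coe_ne_top))
    simpa using this
  refine ge_of_tendsto' hlim fun k => ?_
  have hcomb : ∑ i ∈ s, (φ i k).comb ∈ incrComb :=
    Submodule.sum_mem _ fun i _ => (φ i k).comb_mem
  have hI : (fun ω => (∑ i ∈ s, (φ i k).comb) fun t => L t ω)
      = ∑ i ∈ s, fun ω => (φ i k).comb fun t => L t ω := by
    ext ω
    simp [Finset.sum_apply]
  calc eLpNorm (∑ i ∈ s, stableIntegral P α L (f i)) (ENNReal.ofReal p) P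
      = eLpNorm ((∑ i ∈ s, fun ω => (φ i k).comb fun t => L t ω) -
          ∑ i ∈ s, ((fun ω => (φ i k).comb fun t => L t ω) - stableIntegral P α L (f i)))
          (ENNReal.ofReal p) P := by
        congr 1
        rw [Finset.sum_sub_distrib, sub_sub_cancel]
    _ ≤ eLpNorm (∑ i ∈ s, fun ω => (φ i k).comb fun t => L t ω) (ENNReal.ofReal p) P
        + eLpNorm (∑ i ∈ s, ((fun ω => (φ i k).comb fun t => L t ω)
          - stableIntegral P α L (f i))) (ENNReal.ofReal p) P :=
        eLpNorm_sub_le (Finset.aestronglyMeasurable_sum s fun i _ => hmemI i k)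
          (Finset.aestronglyMeasurable_sum s fun i hi => (hmemI i k).sub (hmemX i hi)) hp1
    _ ≤ K * eLpNorm (∑ i ∈ s, stepOf (φ i k).comb) (ENNReal.ofReal α) volume
        + ∑ i ∈ s, eLpNorm ((fun ω => (φ i k).comb fun t => L t ω)
          - stableIntegral P α L (f i)) (ENNReal.ofReal p) P := by
        gcongr
        · rw [← hI, ← stepOf_sum]
          exact hK _ hcomb
        · exact eLpNorm_sum_le (fun i hi => (hmemI i k).sub (hmemX i hi)) hp1
    _ ≤ _ := by
        rw [add_comm]
        gcongr
        have : ∑ i ∈ s, stepOf (φ i k).comb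
            = ∑ i ∈ s, (stepOf (φ i k).comb - f i) + ∑ i ∈ s, f i := by
          rw [Finset.sum_sub_distrib, sub_add_cancel]
        rw [this]
        refine (eLpNorm_add_le (Finset.aestronglyMeasurable_sum s fun i hi =>
          (hmemS i k).sub (hf i hi).1)
          (Finset.aestronglyMeasurable_sum s fun i hi => (hf i hi).1) hα1).trans ?_
        gcongr
        exact eLpNorm_sum_le (fun i hi => (hmemS i k).sub (hf i hi).1) hα1

end

/-! ### Size and integrability of the fractional kernel -/

theorem rlLeft_eq_setIntegral_Icc {d : ℝ} {g : ℝ → ℝ} (hg1 : ∀ t, t < 0 → g t = 0) (x : ℝ) :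
    rlLeft d g x = (1 / Real.Gamma d) * ∫ t in Set.Icc 0 x, g t * (x - t) ^ (d - 1) := by
  rw [rlLeft]
  congr 1
  refine setIntegral_eq_of_subset_of_forall_sdiff_eq_zero measurableSet_Iic
    Set.Icc_subset_Iic_self fun t ht => ?_
  rw [hg1 t, zero_mul]
  by_contra h
  exact ht.2 ⟨not_lt.1 h, ht.1⟩

/-- Replacing `g` by a measurable representative changes no integral, and makes the integrand
jointly measurable in `(x, t)`. -/
theorem measurable_rlLeft {d : ℝ} {g : ℝ → ℝ} (hg : AEMeasurable g volume) :
    Measurable (rlLeft d g) := by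
  have h1 : rlLeft d g = fun x => (1 / Real.Gamma d) *
      ∫ t, (Set.Iic x).indicator (fun t => hg.mk g t * (x - t) ^ (d - 1)) t := by
    ext x
    rw [rlLeft, integral_indicator measurableSet_Iic]
    congr 1
    refine integral_congr_ae (ae_restrict_of_ae ?_)
    filter_upwards [hg.ae_eq_mk] with t ht
    rw [ht]
  rw [h1]
  refine measurable_const.mul (StronglyMeasurable.integral_prod_right (ν := volume)
    (f := fun x t => (Set.Iic x).indicator (fun t => hg.mk g t * (x - t) ^ (d - 1)) t)
    (Measurable.stronglyMeasurable ?_)).measurable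
  have h2 : Measurable ({q : ℝ × ℝ | q.2 ≤ q.1}.indicator
      fun q => hg.mk g q.2 * (q.1 - q.2) ^ (d - 1)) := by
    refine Measurable.indicator ?_ (measurableSet_le measurable_snd measurable_fst)
    exact (hg.measurable_mk.comp measurable_snd).mul
      ((measurable_fst.sub measurable_snd).pow_const _)
  exact h2

theorem integrableOn_sub_rpow {d : ℝ} (hd : 0 < d) {x : ℝ} (hx : 0 ≤ x) :
    IntegrableOn (fun t => (x - t) ^ (d - 1)) (Set.Icc 0 x) := by
  rw [integrableOn_Icc_iff_integrableOn_Ioc, ← intervalIntegrable_iff_integrableOn_Ioc_of_le hx]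
  have h : IntervalIntegrable (fun u : ℝ => u ^ (d - 1)) volume x 0 :=
    intervalIntegral.intervalIntegrable_rpow' (by linarith)
  simpa using h.comp_sub_left x

theorem setIntegral_sub_rpow {d : ℝ} (hd : 0 < d) {x : ℝ} (hx : 0 ≤ x) :
    ∫ t in Set.Icc 0 x, (x - t) ^ (d - 1) = x ^ d / d := by
  rw [integral_Icc_eq_integral_Ioc, ← intervalIntegral.integral_of_le hx,
    intervalIntegral.integral_comp_sub_left (fun u => u ^ (d - 1)) x, sub_self, sub_zero,
    integral_rpow (Or.inl (by linarith))]
  simp [Real.zero_rpow hd.ne']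

theorem setIntegral_exp_neg_le {c : ℝ} (hc : 0 < c) {x : ℝ} (hx : 0 ≤ x) :
    ∫ t in Set.Icc 0 x, Real.exp (-c * t) ≤ 1 / c := by
  rw [integral_Icc_eq_integral_Ioc, ← intervalIntegral.integral_of_le hx,
    intervalIntegral.integral_comp_mul_left (fun u => Real.exp u) (neg_ne_zero.2 hc.ne'),
    integral_exp]
  simp only [mul_zero, Real.exp_zero, smul_eq_mul]
  rw [show (-c)⁻¹ * (Real.exp (-c * x) - 1) = (1 - Real.exp (-c * x)) / c by field_simp; ring]
  gcongr
  linarith [Real.exp_pos (-c * x)]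

theorem abs_rlLeft_le_of_bound {d : ℝ} (hd : 0 < d) {g : ℝ → ℝ}
    (hg1 : ∀ t, t < 0 → g t = 0) {x : ℝ} {b : ℝ → ℝ} (hb : IntegrableOn b (Set.Icc 0 x))
    (h : ∀ t ∈ Set.Icc 0 x, |g t| * (x - t) ^ (d - 1) ≤ b t) :
    |rlLeft d g x| ≤ 1 / Real.Gamma d * ∫ t in Set.Icc 0 x, b t := by
  have hΓ := Real.Gamma_pos_of_pos hd
  rw [rlLeft_eq_setIntegral_Icc hg1, abs_mul, abs_of_pos (one_div_pos.2 hΓ)]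
  gcongr
  rw [← Real.norm_eq_abs]
  refine norm_integral_le_of_norm_le hb ((ae_restrict_mem measurableSet_Icc).mono fun t ht => ?_)
  rw [norm_mul, Real.norm_eq_abs, Real.norm_eq_abs,
    abs_of_nonneg (Real.rpow_nonneg (sub_nonneg.2 ht.2) _)]
  exact h t ht

theorem abs_rlLeft_le_rpow {d C c : ℝ} (hd : 0 < d) (hC : 0 < C) (hc : 0 < c) {g : ℝ → ℝ}
    (hg1 : ∀ t, t < 0 → g t = 0) (hg2 : ∀ t, |g t| ≤ C * Real.exp (-c * t)) {x : ℝ}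
    (hx : 0 ≤ x) : |rlLeft d g x| ≤ 1 / Real.Gamma d * (C * (x ^ d / d)) := by
  have := abs_rlLeft_le_of_bound hd hg1 ((integrableOn_sub_rpow hd hx).const_mul C)
    fun t ht => by
      have h1 : 0 ≤ (x - t) ^ (d - 1) := Real.rpow_nonneg (sub_nonneg.2 ht.2) _
      have h2 : Real.exp (-c * t) ≤ 1 := Real.exp_le_one_iff.2 (by nlinarith [ht.1])
      have h3 : |g t| ≤ C := (hg2 t).trans (mul_le_of_le_one_right hC.le h2)
      exact mul_le_mul_of_nonneg_right h3 h1
  rwa [integral_const_mul, setIntegral_sub_rpow hd hx] at this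

/-- Split the convolution at `x / 2`. On the left the power is at most `(x/2)^(d-1)` and the
exponential has integral at most `1/c`; on the right `g` is at most `C exp (-c x / 2)`, whose decay
absorbs the extra factor `x` in `x^d / d`. -/
theorem abs_rlLeft_le_rpow_sub_one {d C c : ℝ} (hd : 0 < d) (hd1 : d < 1) (hC : 0 < C)
    (hc : 0 < c) {g : ℝ → ℝ} (hg1 : ∀ t, t < 0 → g t = 0)
    (hg2 : ∀ t, |g t| ≤ C * Real.exp (-c * t)) {x : ℝ} (hx : 0 < x) :
    |rlLeft d g x| ≤ 1 / Real.Gamma d * (C * (2 / c + 2 / (c * d))) * x ^ (d - 1) := by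
  have hΓ := Real.Gamma_pos_of_pos hd
  have hint : IntegrableOn (fun t => Real.exp (-c * t)) (Set.Icc 0 x) :=
    (Continuous.integrableOn_Icc (by fun_prop))
  have hb : ∀ t ∈ Set.Icc 0 x, |g t| * (x - t) ^ (d - 1) ≤
      C * (x / 2) ^ (d - 1) * Real.exp (-c * t)
        + C * Real.exp (-c * (x / 2)) * (x - t) ^ (d - 1) := by
    intro t ht
    have h1 : 0 ≤ (x - t) ^ (d - 1) := Real.rpow_nonneg (sub_nonneg.2 ht.2) _
    refine (mul_le_mul_of_nonneg_right (hg2 t) h1).trans ?_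
    rcases le_total t (x / 2) with h | h
    · have h2 : (x - t) ^ (d - 1) ≤ (x / 2) ^ (d - 1) :=
        Real.rpow_le_rpow_of_nonpos (by positivity) (by linarith) (by linarith)
      have h3 : C * Real.exp (-c * t) * (x - t) ^ (d - 1)
          ≤ C * Real.exp (-c * t) * (x / 2) ^ (d - 1) := by gcongr
      have h4 : 0 ≤ C * Real.exp (-c * (x / 2)) * (x - t) ^ (d - 1) := by positivity
      linarith
    · have h2 : Real.exp (-c * t) ≤ Real.exp (-c * (x / 2)) :=
        Real.exp_le_exp.2 (by nlinarith)
      have h3 : C * Real.exp (-c * t) * (x - t) ^ (d - 1)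
          ≤ C * Real.exp (-c * (x / 2)) * (x - t) ^ (d - 1) := by gcongr
      have h4 : 0 ≤ C * (x / 2) ^ (d - 1) * Real.exp (-c * t) := by positivity
      linarith
  have i1 : IntegrableOn (fun t => C * (x / 2) ^ (d - 1) * Real.exp (-c * t)) (Set.Icc 0 x) :=
    hint.const_mul _
  have i2 : IntegrableOn (fun t => C * Real.exp (-c * (x / 2)) * (x - t) ^ (d - 1))
    (Set.Icc 0 x) := (integrableOn_sub_rpow hd hx.le).const_mul _
  refine (abs_rlLeft_le_of_bound hd hg1 (i1.add i2) hb).trans ?_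
  rw [mul_assoc]
  gcongr
  rw [show (∫ t in Set.Icc 0 x, ((fun t => C * (x / 2) ^ (d - 1) * Real.exp (-c * t))
    + fun t => C * Real.exp (-c * (x / 2)) * (x - t) ^ (d - 1)) t) =
    ∫ t in Set.Icc 0 x, (C * (x / 2) ^ (d - 1) * Real.exp (-c * t)
    + C * Real.exp (-c * (x / 2)) * (x - t) ^ (d - 1)) from rfl,
    integral_add i1 i2, integral_const_mul, integral_const_mul, setIntegral_sub_rpow hd hx.le]
  have hx0 : 0 < x ^ (d - 1) := by positivity
  have e1 : (x / 2) ^ (d - 1) ≤ 2 * x ^ (d - 1) := by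
    rw [div_eq_mul_inv, Real.mul_rpow hx.le (by norm_num), mul_comm]
    gcongr
    rw [Real.inv_rpow (by norm_num), ← Real.rpow_neg (by norm_num)]
    calc (2 : ℝ) ^ (-(d - 1)) ≤ 2 ^ (1 : ℝ) :=
          Real.rpow_le_rpow_of_exponent_le (by norm_num) (by linarith)
      _ = 2 := Real.rpow_one 2
  have e2 : Real.exp (-c * (x / 2)) * x ≤ 2 / c := by
    have := Real.add_one_le_exp (c * (x / 2))
    rw [show -c * (x / 2) = -(c * (x / 2)) by ring, Real.exp_neg, inv_mul_le_iff₀ (Real.exp_pos _),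
      ← div_le_iff₀ (by positivity)]
    calc x / (2 / c) = c * (x / 2) := by field_simp
      _ ≤ _ := by linarith
  have e3 : x ^ d = x * x ^ (d - 1) := by
    rw [← Real.rpow_one_add' hx.le (by linarith)]
    ring_nf
  calc (C * (x / 2) ^ (d - 1) * ∫ t in Set.Icc 0 x, Real.exp (-c * t))
        + C * Real.exp (-c * (x / 2)) * (x ^ d / d)
      ≤ C * (2 * x ^ (d - 1)) * (1 / c) + C * (2 / c) * (x ^ (d - 1) / d) := by
        rw [e3]
        have := mul_le_mul_of_nonneg_left e2 (show 0 ≤ C * (x ^ (d - 1) / d) by positivity)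
        have h1 : C * (x / 2) ^ (d - 1) * ∫ t in Set.Icc 0 x, Real.exp (-c * t)
            ≤ C * (2 * x ^ (d - 1)) * (1 / c) := by
          gcongr
          exact setIntegral_exp_neg_le hc hx.le
        refine add_le_add h1 (le_trans (le_of_eq ?_) (this.trans (le_of_eq ?_))) <;> ring
    _ = C * (2 / c + 2 / (c * d)) * x ^ (d - 1) := by field_simp

/-- The causal kernel `1_{[0, ∞)} I_+^d g` lies in `L^α(ℝ)`. -/
theorem memLp_indicator_rlLeft {α d : ℝ} (hα : 1 < α) (hd : 0 < d) (hdα : d < 1 - 1 / α)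
    {g : ℝ → ℝ} (hg : AEMeasurable g volume) (hg1 : ∀ t, t < 0 → g t = 0)
    (hg2 : ∃ C > 0, ∃ c > 0, ∀ t, |g t| ≤ C * Real.exp (-c * t)) :
    MemLp ((Set.Ici 0).indicator (rlLeft d g)) (ENNReal.ofReal α) volume := by
  obtain ⟨C, hC, c, hc, hgC⟩ := hg2
  have hα0 : 0 < α := by linarith
  have hΓ := Real.Gamma_pos_of_pos hd
  have hd1 : d < 1 := by
    have : 0 < 1 / α := by positivity
    linarith
  set A := 1 / Real.Gamma d * (C * (1 / d)) with hA
  set B := 1 / Real.Gamma d * (C * (2 / c + 2 / (c * d))) with hB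
  have hA0 : 0 ≤ A := by positivity
  have m1 : MemLp ((Set.Icc (0 : ℝ) 1).indicator fun _ => A) (ENNReal.ofReal α) volume :=
    memLp_indicator_const _ measurableSet_Icc _ (Or.inr (by simp))
  have m2 : MemLp ((Set.Ioi (1 : ℝ)).indicator fun x => B * x ^ (d - 1)) (ENNReal.ofReal α)
      volume := by
    rw [memLp_indicator_iff_restrict measurableSet_Ioi]
    refine MemLp.const_mul ?_ B
    rw [← integrable_norm_rpow_iff (by fun_prop) (by simpa using hα0) ENNReal.ofReal_ne_top,
      ENNReal.toReal_ofReal hα0.le]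
    -- Integrability of `x^((d-1)α)` at infinity is exactly the condition `d < 1 - 1/α`.
    have hexp : (d - 1) * α < -1 := by
      have : (1 - 1 / α) * α = α - 1 := by field_simp
      nlinarith
    refine (integrableOn_Ioi_rpow_of_lt hexp one_pos).congr_fun_ae
      ((ae_restrict_mem measurableSet_Ioi).mono fun x (hx : 1 < x) => ?_)
    have hx0 : 0 < x := by linarith
    simp only
    rw [Real.norm_of_nonneg (by positivity), ← Real.rpow_mul hx0.le]
  refine (m1.add m2).mono
    ((measurable_rlLeft hg).indicator measurableSet_Ici).aestronglyMeasurable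
    (ae_of_all _ fun x => ?_)
  simp only [Pi.add_apply, Set.indicator_apply, Set.mem_Ici, Set.mem_Icc, Set.mem_Ioi]
  by_cases hx : 0 ≤ x
  · rcases le_or_gt x 1 with h | h
    · simp only [hx, h, not_lt.2 h, if_true, if_false, and_self, add_zero]
      rw [Real.norm_eq_abs, Real.norm_of_nonneg hA0]
      refine (abs_rlLeft_le_rpow hd hC hc hg1 hgC hx).trans ?_
      rw [hA]
      gcongr
      exact Real.rpow_le_one hx h hd.le
    · simp only [hx, h, not_le.2 h, if_true, if_false, and_false, zero_add]
      rw [Real.norm_eq_abs, Real.norm_eq_abs]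
      exact (abs_rlLeft_le_rpow_sub_one hd hd1 hC hc hg1 hgC (by linarith)).trans (le_abs_self _)
  · simp only [hx, if_false, norm_zero]
    positivity

theorem fimaKernel_eq (d : ℝ) (g : ℝ → ℝ) (t : ℝ) :
    fimaKernel d g t = fun x => (Set.Ici 0).indicator (rlLeft d g) (t - x) := by
  ext x
  simp [fimaKernel, Set.indicator_apply]

/-! ### Averages of integer translates -/

theorem card_filter_abs_sub_le (s : Finset ℕ) {R : ℝ} (hR : 0 ≤ R) (x : ℝ) :
    ((s.filter fun j : ℕ => |(j : ℝ) - x| ≤ R).card : ℝ) ≤ 2 * R + 1 := by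
  have h1 : (s.filter fun j : ℕ => |(j : ℝ) - x| ≤ R).card
      ≤ (Finset.Icc ⌈x - R⌉ ⌊x + R⌋).card := by
    refine Finset.card_le_card_of_injOn (fun j => (j : ℤ)) (fun j hj => ?_)
      Nat.cast_injective.injOn
    have hj' := abs_le.1 (Finset.mem_filter.1 hj).2
    simp only [Finset.coe_Icc, Set.mem_Icc, Int.ceil_le, Int.le_floor, Int.cast_natCast]
    constructor <;> linarith [hj'.1, hj'.2]
  refine (Nat.cast_le.2 h1).trans ?_
  rw [Int.card_Icc]
  have h2 := Int.floor_le (x + R)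
  have h3 := Int.le_ceil (x - R)
  rcases le_total 0 (⌊x + R⌋ + 1 - ⌈x - R⌉) with h | h
  · have : (((⌊x + R⌋ + 1 - ⌈x - R⌉).toNat : ℤ) : ℝ) = ⌊x + R⌋ + 1 - ⌈x - R⌉ := by
      rw [Int.toNat_of_nonneg h]; push_cast; ring
    rw [Int.cast_natCast] at this
    linarith
  · rw [Int.toNat_of_nonpos h]
    simp only [Nat.cast_zero]
    positivity

/-- At each `x` at most `2R + 1` translates are nonzero, however large `n` is, and all of them live
on `[-R, n + R]`. -/
theorem abs_sum_translates_le {h : ℝ → ℝ} {B R : ℝ} (hR : 0 ≤ R) (hB : ∀ x, |h x| ≤ B)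
    (hsupp : ∀ x, R < |x| → h x = 0) (n : ℕ) (x : ℝ) :
    |∑ j ∈ Finset.Icc 1 n, h (j - x)|
      ≤ (Set.Icc (-R) (n + R)).indicator (fun _ => B * (2 * R + 1)) x := by
  have hB0 : 0 ≤ B := (abs_nonneg _).trans (hB 0)
  by_cases hx : x ∈ Set.Icc (-R) (n + R)
  · rw [Set.indicator_of_mem hx]
    rw [← Finset.sum_filter_of_ne (p := fun j : ℕ => |(j : ℝ) - x| ≤ R) fun j _ hj => by
      by_contra hlt
      exact hj (hsupp _ (not_le.1 hlt))]
    refine (Finset.abs_sum_le_sum_abs _ _).trans ?_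
    refine (Finset.sum_le_card_nsmul _ _ B fun j _ => hB _).trans ?_
    rw [nsmul_eq_mul, mul_comm]
    gcongr
    exact card_filter_abs_sub_le _ hR x
  · rw [Set.indicator_of_notMem hx, Finset.sum_eq_zero, abs_zero]
    intro j hj
    refine hsupp _ (not_le.1 fun hle => hx ?_)
    have h1 := abs_le.1 hle
    have h2 : (0 : ℝ) ≤ j := Nat.cast_nonneg j
    have h3 : (j : ℝ) ≤ n := by exact_mod_cast (Finset.mem_Icc.1 hj).2
    exact ⟨by linarith [h1.2], by linarith [h1.1]⟩

/-- Averages of translates of a function do not increase the `L^q` norm. -/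
theorem eLpNorm_average_translates_le {u : ℝ → ℝ} {q : ENNReal} (hq : 1 ≤ q)
    (hu : AEStronglyMeasurable u volume) {n : ℕ} (hn : 1 ≤ n) :
    eLpNorm ((n : ℝ)⁻¹ • ∑ j ∈ Finset.Icc 1 n, fun x => u (j - x)) q volume
      ≤ eLpNorm u q volume := by
  have hmp : ∀ j : ℕ, MeasurePreserving (fun x : ℝ => (j : ℝ) - x) volume volume :=
    fun j => Measure.measurePreserving_sub_left volume (j : ℝ)
  have hn0 : (0 : ℝ) < n := by exact_mod_cast hn
  have hnorm : ∀ j ∈ Finset.Icc 1 n,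
      eLpNorm (fun x => u (j - x)) q volume = eLpNorm u q volume := fun j _ =>
    eLpNorm_comp_measurePreserving hu (hmp j)
  have hsum : eLpNorm (∑ j ∈ Finset.Icc 1 n, fun x => u (j - x)) q volume
      ≤ n * eLpNorm u q volume := by
    refine (eLpNorm_sum_le (fun j _ => hu.comp_measurePreserving (hmp j)) hq).trans ?_
    refine (Finset.sum_le_sum fun j hj => (hnorm j hj).le).trans (le_of_eq ?_)
    simp
  rw [eLpNorm_const_smul, Real.enorm_of_nonneg (inv_nonneg.2 hn0.le)]
  refine (mul_le_mul' le_rfl hsum).trans (le_of_eq ?_)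
  rw [← mul_assoc, ENNReal.ofReal_inv_of_pos hn0, ENNReal.ofReal_natCast,
    ENNReal.inv_mul_cancel (by exact_mod_cast hn0.ne') (by simp), one_mul]

/-- The sum is bounded on a set of length `n + 2R`, so its norm is of order at most `n^(1/α)`;
division by `n` gives the exponent. -/
theorem eLpNorm_average_translates_le_rpow {α : ℝ} (hα : 0 < α) {h : ℝ → ℝ} {B R : ℝ}
    (hR : 0 ≤ R) (hB : ∀ x, |h x| ≤ B) (hsupp : ∀ x, R < |x| → h x = 0) {n : ℕ} (hn : 1 ≤ n) :
    eLpNorm ((n : ℝ)⁻¹ • ∑ j ∈ Finset.Icc 1 n, fun x => h (j - x)) (ENNReal.ofReal α) volume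
      ≤ ENNReal.ofReal (B * (2 * R + 1) * (1 + 2 * R) ^ (1 / α) * (n : ℝ) ^ (-(1 - 1 / α))) := by
  have hB0 : 0 ≤ B := (abs_nonneg _).trans (hB 0)
  have hn1 : (1 : ℝ) ≤ n := by exact_mod_cast hn
  have hn0 : (0 : ℝ) < n := by linarith
  have hsum : eLpNorm (∑ j ∈ Finset.Icc 1 n, fun x => h (j - x)) (ENNReal.ofReal α) volume
      ≤ ENNReal.ofReal (B * (2 * R + 1) * (n + 2 * R) ^ (1 / α)) := by
    refine (eLpNorm_mono_real (g := (Set.Icc (-R) (n + R)).indicator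
      (fun _ => B * (2 * R + 1))) fun x => ?_).trans ?_
    · rw [Finset.sum_apply, Real.norm_eq_abs]
      exact abs_sum_translates_le hR hB hsupp n x
    · refine (eLpNorm_indicator_const_le _ _).trans (le_of_eq ?_)
      rw [Real.volume_Icc, ENNReal.toReal_ofReal hα.le,
        Real.enorm_of_nonneg (by positivity), show (n : ℝ) + R - -R = n + 2 * R by ring,
        ENNReal.ofReal_rpow_of_nonneg (by linarith) (by positivity),
        ← ENNReal.ofReal_mul (by positivity)]
  rw [eLpNorm_const_smul, Real.enorm_of_nonneg (inv_nonneg.2 hn0.le)]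
  refine (mul_le_mul' le_rfl hsum).trans ?_
  rw [← ENNReal.ofReal_mul (inv_nonneg.2 hn0.le)]
  refine ENNReal.ofReal_le_ofReal ?_
  calc (n : ℝ)⁻¹ * (B * (2 * R + 1) * (n + 2 * R) ^ (1 / α))
      ≤ (n : ℝ)⁻¹ * (B * (2 * R + 1) * ((1 + 2 * R) * n) ^ (1 / α)) := by
        gcongr
        nlinarith
    _ = B * (2 * R + 1) * (1 + 2 * R) ^ (1 / α) * (n : ℝ) ^ (-(1 - 1 / α)) := by
        rw [Real.mul_rpow (by positivity) hn0.le,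
          show -(1 - 1 / α) = 1 / α + (-1) by ring, Real.rpow_add hn0, Real.rpow_neg_one]
        ring

/-- A mean ergodic theorem for integer translations: averages of translates of an `L^α` function,
`1 < α`, tend to `0` in `L^α(ℝ)`. -/
theorem MeasureTheory.MemLp.tendsto_eLpNorm_average_translates {α : ℝ} (hα : 1 < α) {f : ℝ → ℝ}
    (hf : MemLp f (ENNReal.ofReal α) volume) :
    Tendsto (fun n : ℕ => eLpNorm ((n : ℝ)⁻¹ • ∑ j ∈ Finset.Icc 1 n, fun x => f (j - x))
      (ENNReal.ofReal α) volume) atTop (𝓝 0) := by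
  have hα0 : 0 < α := by linarith
  have hα1 : 1 ≤ ENNReal.ofReal α := by simpa using hα.le
  rw [ENNReal.tendsto_nhds_zero]
  intro ε hε
  obtain ⟨h, hcs, hfh, hcont, hmem⟩ := hf.exists_hasCompactSupport_eLpNorm_sub_le
    ENNReal.ofReal_ne_top (ENNReal.half_pos hε.ne').ne'
  obtain ⟨B, hB⟩ := hcont.bounded_above_of_compact_support hcs
  obtain ⟨R, hR⟩ := hcs.isCompact.isBounded.subset_closedBall 0
  have hsupp : ∀ x, |R| < |x| → h x = 0 := by
    intro x hx
    by_contra hne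
    have := hR (subset_tsupport _ hne)
    rw [mem_closedBall_zero_iff, Real.norm_eq_abs] at this
    exact absurd (this.trans (le_abs_self R)) (not_le.2 hx)
  set D := B * (2 * |R| + 1) * (1 + 2 * |R|) ^ (1 / α)
  have hlim : Tendsto (fun n : ℕ => ENNReal.ofReal (D * (n : ℝ) ^ (-(1 - 1 / α)))) atTop
      (𝓝 0) := by
    have h1 : 0 < 1 - 1 / α := by
      rw [sub_pos, div_lt_one hα0]; exact hα
    have h2 := ((tendsto_rpow_neg_atTop h1).comp tendsto_natCast_atTop_atTop).const_mul D
    simpa using ENNReal.tendsto_ofReal h2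
  filter_upwards [(ENNReal.tendsto_nhds_zero.1 hlim) (ε / 2) (ENNReal.half_pos hε.ne'),
    eventually_ge_atTop 1] with n hn hn1
  have hmp : ∀ j : ℕ, MeasurePreserving (fun x : ℝ => (j : ℝ) - x) volume volume :=
    fun j => Measure.measurePreserving_sub_left volume (j : ℝ)
  have hmf : ∀ j : ℕ, AEStronglyMeasurable (fun x => (f - h) (j - x)) volume := fun j =>
    (hf.1.sub hmem.1).comp_measurePreserving (hmp j)
  have hmh : ∀ j : ℕ, AEStronglyMeasurable (fun x => h (j - x)) volume := fun j =>
    hmem.1.comp_measurePreserving (hmp j)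
  -- The average of `f - h` is small by contractivity, uniformly in `n`; that of `h` by the decay
  -- rate for compact support.
  have hdecomp : ((n : ℝ)⁻¹ • ∑ j ∈ Finset.Icc 1 n, fun x => f (j - x))
      = ((n : ℝ)⁻¹ • ∑ j ∈ Finset.Icc 1 n, fun x => (f - h) (j - x))
        + (n : ℝ)⁻¹ • ∑ j ∈ Finset.Icc 1 n, fun x => h (j - x) := by
    rw [← smul_add, ← Finset.sum_add_distrib]
    congr 1
    refine Finset.sum_congr rfl fun j _ => ?_
    ext x
    simp
  rw [hdecomp]
  calc _ ≤ _ + _ := eLpNorm_add_le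
        ((Finset.aestronglyMeasurable_sum _ fun j _ => hmf j).const_smul _)
        ((Finset.aestronglyMeasurable_sum _ fun j _ => hmh j).const_smul _) hα1
    _ ≤ ε / 2 + ε / 2 := add_le_add
        ((eLpNorm_average_translates_le hα1 (hf.1.sub hmem.1) hn1).trans hfh)
        ((eLpNorm_average_translates_le_rpow hα0 (abs_nonneg R) hB hsupp hn1).trans hn)
    _ = ε := ENNReal.add_halves ε

/-! ### The law of large numbers -/

theorem theorem4p5 {Ω : Type*} [MeasurableSpace Ω] (P : Measure Ω) [IsProbabilityMeasure P]
    (α d p : ℝ) (hα : 1 < α ∧ α < 2) (hd : 0 < d ∧ d < 1 - 1 / α) (hp : 1 < p ∧ p < α)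
    (L : ℝ → Ω → ℝ) (hL : IsSaSLevyMotion P α L)
    (g : ℝ → ℝ) (hg : AEMeasurable g volume) (hg1 : ∀ t, t < 0 → g t = 0)
    (hg2 : ∃ C > 0, ∃ c > 0, ∀ t, |g t| ≤ C * Real.exp (-c * t)) :
    (∀ t, IsStableIntegral P α L (fimaKernel d g t) (fimaProcess P α L d g t)) ∧
    (∀ n, MemLp (fimaPartialSum P α L d g n) (ENNReal.ofReal p) P) ∧
    Tendsto (fun n : ℕ => eLpNorm (fun ω => fimaPartialSum P α L d g n ω / (n : ℝ))
      (ENNReal.ofReal p) P) atTop (𝓝 0) := by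
  have hmem := memLp_indicator_rlLeft hα.1 hd.1 hd.2 hg hg1 hg2
  have hker : ∀ t, MemLp (fimaKernel d g t) (ENNReal.ofReal α) volume := fun t => by
    rw [fimaKernel_eq]
    exact hmem.comp_measurePreserving (Measure.measurePreserving_sub_left volume t)
  have hspec := fun t => hL.stableIntegral_spec hp.1.le hp.2 (hker t)
  have hsum : ∀ n, fimaPartialSum P α L d g n
      = ∑ j ∈ Finset.Icc 1 n, stableIntegral P α L (fimaKernel d g (j : ℝ)) := fun n => by
    ext ω
    simp [fimaPartialSum, fimaProcess, Finset.sum_apply]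
  refine ⟨fun t => (hspec t).1, fun n => ?_, ?_⟩
  · rw [hsum]
    exact memLp_finsetSum' _ fun j _ => (hspec j).2.1
  · obtain ⟨K, hK⟩ := hL.exists_eLpNorm_sum_stableIntegral_le hp.1.le hp.2
    have hlim := ENNReal.Tendsto.const_mul (a := (K : ENNReal))
      (hmem.tendsto_eLpNorm_average_translates hα.1) (Or.inr ENNReal.coe_ne_top)
    rw [mul_zero] at hlim
    refine tendsto_of_tendsto_of_tendsto_of_le_of_le tendsto_const_nhds hlim
      (fun _ => zero_le) fun n => ?_
    have hdiv : (fun ω => fimaPartialSum P α L d g n ω / (n : ℝ))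
        = (n : ℝ)⁻¹ • fimaPartialSum P α L d g n := by
      ext ω
      simp [div_eq_inv_mul]
    have hbd := hK (Finset.Icc 1 n) (fun j : ℕ => fimaKernel d g (j : ℝ)) fun j _ => hker j
    simp only [fimaKernel_eq] at hbd
    simp only
    -- The factor `n⁻¹` comes out of both norms, which leaves the bound for the unnormalised sums.
    rw [hdiv, eLpNorm_const_smul, eLpNorm_const_smul, hsum, mul_left_comm]
    simp only [fimaKernel_eq]
    gcongr
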